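/- Let $d\ge 1$ be an integer and let $\mathcal G_{1,d}=\{P\in\mathbb R^{d\times d}: P^\top=P,\ P^2=P,\ \operatorname{trace}(P)=1\}$ be the set of rank-one orthogonal projections on $\mathbb R^d$. Let $\sigma_{1,d}$ be the orthogonally invariant probability measure on $\mathcal G_{1,d}$ induced by the Haar measure on the orthogonal group $\mathcal O(d)$ acting by $P\mapsto UPU^*$. For symmetric matrices $A,B\in\mathbb R^{d\times d}$ and integers $p,q\ge 0$ define the trace moment $$\mu^{(p,q)}_{1,d}(A,B)=\int_{\mathcal G_{1,d}}\operatorname{trace}(PA)^p\,\operatorname{trace}(PB)^q\,d\sigma_{1,d}(P),$$ and for $x,y\in\mathbb R^d$ put $E_{x,y}=\tfrac12(xy^*+yx^*)$. **Proposition 3.3.** Let $m,\ell\ge 0$ be integers with $d\ge m+\ell$. Then there are real coefficients $a_0,\dots,a_{\lfloor m/2\rfloor}$ (depending only on $m$, $\ell$ and $d$) such that, for all $x\in\mathbb R^d$ and all $y\in\mathbb R^d$ with $\|y\|=1$, $$\langle x,y\rangle^m\,\|x\|^{2\ell}=\sum_{i=0}^{\lfloor m/2\rfloor} a_i\,\mu^{(m-2i,\,\ell+i)}_{1,d}(E_{x,y},xx^*).$$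 -/

import Mathlib

open MeasureTheory

/-- The Grassmann space `𝒢_{k,d}`: the symmetric idempotent real `d × d` matrices of trace `k`,
i.e. the orthogonal projections of rank `k` on `ℝ^d`. -/
def Grassmannian (k d : ℕ) : Set (Matrix (Fin d) (Fin d) ℝ) :=
  {P | P.transpose = P ∧ P * P = P ∧ P.trace = (k : ℝ)}

/-- The Borel σ-algebra on the orthogonal group `𝒪(d)`. -/
instance orthogonalGroupMeasurableSpace (d : ℕ) :
    MeasurableSpace (Matrix.orthogonalGroup (Fin d) ℝ) := borel _

instance orthogonalGroupBorelSpace (d : ℕ) :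
    BorelSpace (Matrix.orthogonalGroup (Fin d) ℝ) := ⟨rfl⟩

/-- The Borel σ-algebra on `𝒢_{k,d}` (with the topology induced from the matrices). -/
instance grassmannianMeasurableSpace (k d : ℕ) : MeasurableSpace (Grassmannian k d) := borel _

instance grassmannianBorelSpace (k d : ℕ) : BorelSpace (Grassmannian k d) := ⟨rfl⟩

/-- The orthogonal group is compact. -/
instance orthogonalGroupCompactSpace (d : ℕ) :
    CompactSpace (Matrix.orthogonalGroup (Fin d) ℝ) := by
  refine isCompact_iff_compactSpace.mp ?_
  have hK : IsCompact (Set.pi Set.univ fun _ : Fin d => Set.pi Set.univ fun _ : Fin d =>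
      Set.Icc (-1 : ℝ) 1) :=
    isCompact_univ_pi fun _ => isCompact_univ_pi fun _ => isCompact_Icc
  refine IsCompact.of_isClosed_subset
    (s := (show Set (Matrix (Fin d) (Fin d) ℝ) from
      Set.pi Set.univ fun _ : Fin d => Set.pi Set.univ fun _ : Fin d => Set.Icc (-1 : ℝ) 1))
    hK ?_ ?_
  · have h : (Matrix.orthogonalGroup (Fin d) ℝ : Set (Matrix (Fin d) (Fin d) ℝ)) =
        {A | A * A.transpose = 1} := by
      ext A
      exact Matrix.mem_orthogonalGroup_iff (Fin d) ℝ
    rw [h]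
    exact isClosed_eq (by fun_prop) continuous_const
  · intro U hU i _ j _
    have h := entry_norm_bound_of_unitary (𝕜 := ℝ) hU i j
    rw [Real.norm_eq_abs, abs_le] at h
    exact h

/-- The Haar measure on `𝒪(d)`, normalized to total mass one. -/
noncomputable def orthogonalHaar (d : ℕ) : Measure (Matrix.orthogonalGroup (Fin d) ℝ) :=
  Measure.haarMeasure ⊤

/-- The diagonal matrix `D_k` with `k` ones followed by zeros. -/
def coordProj (k d : ℕ) : Matrix (Fin d) (Fin d) ℝ :=
  Matrix.diagonal fun i => if (i : ℕ) < k then 1 else 0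

theorem coordProj_mem {k d : ℕ} (h : k ≤ d) : coordProj k d ∈ Grassmannian k d := by
  refine ⟨by simp [coordProj], ?_, ?_⟩
  · simp [coordProj, Matrix.diagonal_mul_diagonal]
  · simp only [coordProj, Matrix.trace_diagonal, Finset.sum_boole, Nat.cast_inj]
    simp [Fin.card_filter_val_lt, h]

/-- The action of `U ∈ 𝒪(d)` on `P ∈ 𝒢_{k,d}` by conjugation, `P ↦ U P U*`. -/
def grassmannianConj {k d : ℕ} (U : Matrix.orthogonalGroup (Fin d) ℝ) (P : Grassmannian k d) :
    Grassmannian k d :=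
  ⟨U.1 * P.1 * U.1.transpose, by
    obtain ⟨P, hT, hI, ht⟩ := P
    have hU : U.1.transpose * U.1 = 1 := (Matrix.mem_orthogonalGroup_iff' (Fin d) ℝ).1 U.2
    refine ⟨?_, ?_, ?_⟩
    · simp [Matrix.transpose_mul, hT, Matrix.mul_assoc]
    · calc U.1 * P * U.1.transpose * (U.1 * P * U.1.transpose)
          = U.1 * P * (U.1.transpose * U.1) * P * U.1.transpose := by
            simp only [Matrix.mul_assoc]
        _ = U.1 * (P * P) * U.1.transpose := by simp [hU, Matrix.mul_assoc]
        _ = U.1 * P * U.1.transpose := by rw [hI]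
    · rw [Matrix.trace_mul_comm, ← Matrix.mul_assoc, hU, Matrix.one_mul]
      exact ht⟩

/-- The orthogonally invariant probability measure `σ_{k,d}` on `𝒢_{k,d}` induced by the Haar
measure of `𝒪(d)`: the law of `U D_k U*` for a Haar distributed `U`. -/
noncomputable def grassmannianMeasure {k d : ℕ} (h : k ≤ d) : Measure (Grassmannian k d) :=
  (orthogonalHaar d).map fun U => grassmannianConj U ⟨coordProj k d, coordProj_mem h⟩

/-- The trace moment `μ_{k,d}(M_1, …, M_t) = ∫ ⟨P, M_1⟩ ⋯ ⟨P, M_t⟩ dσ_{k,d}(P)`, where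
`⟨P, M⟩ = trace (P M)`. -/
noncomputable def traceMoment {k d : ℕ} (h : k ≤ d) {t : ℕ}
    (M : Fin t → Matrix (Fin d) (Fin d) ℝ) : ℝ :=
  ∫ P : Grassmannian k d, ∏ i, (P.1 * M i).trace ∂(grassmannianMeasure h)

/-- The trace moment `μ^{(m,ℓ)}_{k,d}(A, B) = μ_{k,d}(A, …, A, B, …, B)`, in which `A` occurs `m`
times and `B` occurs `ℓ` times. -/
noncomputable def mixedTraceMoment {k d : ℕ} (h : k ≤ d) (m l : ℕ)
    (A B : Matrix (Fin d) (Fin d) ℝ) : ℝ :=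
  traceMoment h (Fin.append (fun _ : Fin m => A) (fun _ : Fin l => B))

/-- The symmetric matrix `E_{x,y} = (x y* + y x*) / 2`. -/
noncomputable def symOuter {d : ℕ} (x y : EuclideanSpace ℝ (Fin d)) :
    Matrix (Fin d) (Fin d) ℝ :=
  (1 / 2 : ℝ) • (Matrix.vecMulVec x.ofLp y.ofLp + Matrix.vecMulVec y.ofLp x.ofLp)

/-! A random rank-one projection is `P = u uᵀ`, with `u` a column of a Haar distributed orthogonal
matrix. Then `trace (P E_{x,y}) = ⟨x,u⟩⟨y,u⟩` and `trace (P x xᵀ) = ⟨x,u⟩²`, so the `i`-th moment in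
the sum is `S(m+2l, m-2i)`, where `S(a,b) = ∫ ⟨x,u⟩^a ⟨y,u⟩^b`; the exponent of `⟨x,u⟩` does not
depend on `i`. Rotation invariance gives the recursion `sphereMoment_succ_right`: `(d-1+a+b)
S(a,b+1) = a ⟨x,y⟩ S(a-1,b) + b ‖y‖² S(a,b-1)`. Solved for `⟨x,y⟩ S(a-1,b)` with `‖y‖ = 1`, it turns
a factor `⟨x,y⟩` into a combination of moments with one more `⟨x,u⟩`. Induction on `m` follows,
starting from `‖x‖^(2l) = c S(2l,0)`. -/

/-! ### Rotation flows and Haar measure. -/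

theorem Matrix.exp_smul_mem_orthogonalGroup {n : Type*} [Fintype n] [DecidableEq n]
    {A : Matrix n n ℝ} (hA : A.transpose = -A) (t : ℝ) :
    NormedSpace.exp (t • A) ∈ Matrix.orthogonalGroup n ℝ := by
  rw [Matrix.mem_orthogonalGroup_iff, ← Matrix.exp_transpose,
    Matrix.transpose_smul, hA, smul_neg, Matrix.exp_neg]
  exact Matrix.mul_nonsing_inv _ ((Matrix.isUnit_iff_isUnit_det _).1 (Matrix.isUnit_exp _))

theorem Matrix.hasDerivAt_exp_smul_mulVec {n : Type*} [Fintype n] [DecidableEq n]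
    (A : Matrix n n ℝ) (v : n → ℝ) (t : ℝ) :
    HasDerivAt (fun s : ℝ => (NormedSpace.exp (s • A)).mulVec v)
      (A.mulVec ((NormedSpace.exp (t • A)).mulVec v)) t := by
  let : NormedRing (Matrix n n ℝ) := Matrix.linftyOpNormedRing
  let : NormedAlgebra ℝ (Matrix n n ℝ) := Matrix.linftyOpNormedAlgebra
  have h := hasDerivAt_exp_smul_const' (𝕂 := ℝ) A t
  let L : Matrix n n ℝ →ₗ[ℝ] (n → ℝ) := (Matrix.mulVecBilin ℝ ℝ).flip v
  have h2 := (LinearMap.toContinuousLinearMap L).hasFDerivAt.comp_hasDerivAt t h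
  rw [Matrix.mulVec_mulVec]
  exact h2

instance orthogonalHaar_isProbabilityMeasure (d : ℕ) :
    IsProbabilityMeasure (orthogonalHaar d) :=
  ⟨by
    rw [orthogonalHaar, ← TopologicalSpace.PositiveCompacts.coe_top]
    exact Measure.haarMeasure_self⟩

instance orthogonalHaar_isMulLeftInvariant (d : ℕ) :
    (orthogonalHaar d).IsMulLeftInvariant := by
  unfold orthogonalHaar; infer_instance

/-- The column of an orthogonal matrix with index `j`. -/
def orthogonalCol {d : ℕ} (j : Fin d) (U : Matrix.orthogonalGroup (Fin d) ℝ) : Fin d → ℝ :=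
  U.1.mulVec (Pi.single j 1)

theorem continuous_orthogonalCol {d : ℕ} (j : Fin d) : Continuous (orthogonalCol j) := by
  unfold orthogonalCol; fun_prop

theorem orthogonalCol_apply {d : ℕ} (j i : Fin d) (U : Matrix.orthogonalGroup (Fin d) ℝ) :
    orthogonalCol j U i = U.1 i j := by
  simp [orthogonalCol]

theorem orthogonalCol_dotProduct_self {d : ℕ} (j : Fin d)
    (U : Matrix.orthogonalGroup (Fin d) ℝ) :
    orthogonalCol j U ⬝ᵥ orthogonalCol j U = 1 := by
  have h := congrFun₂ ((Matrix.mem_orthogonalGroup_iff' (Fin d) ℝ).1 U.2) j j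
  simpa [Matrix.mul_apply, dotProduct, orthogonalCol_apply, Matrix.star_apply] using h

theorem integrable_orthogonalHaar {d : ℕ} {f : Matrix.orthogonalGroup (Fin d) ℝ → ℝ}
    (hf : Continuous f) : Integrable f (orthogonalHaar d) :=
  (integrableOn_univ).1 (hf.continuousOn.integrableOn_compact isCompact_univ)

/-- Infinitesimal rotations have mean zero. -/
theorem integral_fderiv_skew_eq_zero {d : ℕ} (j : Fin d) {A : Matrix (Fin d) (Fin d) ℝ}
    (hA : A.transpose = -A) {f : (Fin d → ℝ) → ℝ} (hf : ContDiff ℝ 1 f) :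
    ∫ U, fderiv ℝ f (orthogonalCol j U) (A.mulVec (orthogonalCol j U)) ∂(orthogonalHaar d) = 0 := by
  let R : ℝ → Matrix.orthogonalGroup (Fin d) ℝ :=
    fun t => ⟨_, Matrix.exp_smul_mem_orthogonalGroup hA t⟩
  let h : Matrix.orthogonalGroup (Fin d) ℝ → ℝ :=
    fun U => fderiv ℝ f (orthogonalCol j U) (A.mulVec (orthogonalCol j U))
  have hu := continuous_orthogonalCol j
  have hh : Continuous h :=
    ((hf.continuous_fderiv one_ne_zero).comp hu).clm_apply
      (Continuous.matrix_mulVec continuous_const hu)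
  have hfu : Continuous fun U => f (orthogonalCol j U) := hf.continuous.comp hu
  obtain ⟨C, hC⟩ := isCompact_univ.exists_bound_of_continuousOn hh.continuousOn
  have hcol (t : ℝ) (U) : orthogonalCol j (R t * U)
      = (NormedSpace.exp (t • A)).mulVec (orthogonalCol j U) := by
    simp only [orthogonalCol, R, Matrix.mulVec_mulVec, Submonoid.coe_mul]
  -- Differentiate `∫ f (exp(tA) u)` at `t = 0`. By left invariance this integral is constant in
  -- `t`. The bound `C` is uniform in `t` because `R t * U` stays in the compact group.
  have hd := (hasDerivAt_integral_of_dominated_loc_of_deriv_le (μ := orthogonalHaar d) (𝕜 := ℝ)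
    (F := fun t U => f (orthogonalCol j (R t * U))) (F' := fun t U => h (R t * U))
    (x₀ := 0) (s := Set.univ) (bound := fun _ => C) Filter.univ_mem
    (Filter.Eventually.of_forall fun t =>
      (hfu.comp (continuous_const_mul (R t))).aestronglyMeasurable)
    (integrable_orthogonalHaar (hfu.comp (continuous_const_mul (R 0))))
    (hh.comp (continuous_const_mul (R 0))).aestronglyMeasurable
    (Filter.Eventually.of_forall fun U t _ => hC _ trivial)
    (integrable_const C)
    (Filter.Eventually.of_forall fun U t _ => by
      have := ((hf.differentiable one_ne_zero) (orthogonalCol j (R t * U))).hasFDerivAt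
      simp only [h, hcol] at this ⊢
      exact this.comp_hasDerivAt t (Matrix.hasDerivAt_exp_smul_mulVec A _ t))).2
  have hconst (t : ℝ) : ∫ U, f (orthogonalCol j (R t * U)) ∂(orthogonalHaar d)
      = ∫ U, f (orthogonalCol j U) ∂(orthogonalHaar d) :=
    integral_mul_left_eq_self (fun U => f (orthogonalCol j U)) (R t)
  simp only [hconst] at hd
  have := hd.unique (hasDerivAt_const (0 : ℝ) _)
  rwa [integral_mul_left_eq_self h (R 0)] at this

/-- Integration by parts on the sphere for a homogeneous function of degree `k`. -/
theorem integral_dotProduct_mul_of_homogeneous {d : ℕ} (j : Fin d) (y : Fin d → ℝ) (k : ℝ)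
    {g : (Fin d → ℝ) → ℝ} (hg : ContDiff ℝ 1 g) (hk : ∀ u, fderiv ℝ g u u = k * g u) :
    (d - 1 + k) * ∫ U, (y ⬝ᵥ orthogonalCol j U) * g (orthogonalCol j U) ∂(orthogonalHaar d)
      = ∫ U, fderiv ℝ g (orthogonalCol j U) y ∂(orthogonalHaar d) := by
  have hu := continuous_orthogonalCol j
  have hg' := hg.continuous_fderiv one_ne_zero
  -- The generator of rotations in the plane of `e_i` and `y`. Applying it to `u_i g(u)` and summing
  -- over `i` isolates the derivative of `g` along `y`.
  let A : Fin d → Matrix (Fin d) (Fin d) ℝ := fun i =>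
    Matrix.vecMulVec (Pi.single i 1) y - Matrix.vecMulVec y (Pi.single i 1)
  have hA (i) : (A i).transpose = -A i := by
    simp [A, Matrix.transpose_sub, Matrix.transpose_vecMulVec]
  have hAu (i) (u : Fin d → ℝ) : (A i).mulVec u = (y ⬝ᵥ u) • Pi.single i 1 - u i • y := by
    simp [A, Matrix.sub_mulVec, Matrix.vecMulVec_mulVec]
  let f : Fin d → (Fin d → ℝ) → ℝ := fun i u => u i * g u
  have hf (i) : ContDiff ℝ 1 (f i) := (contDiff_apply ℝ ℝ i).mul hg
  have hfd (i) (u v : Fin d → ℝ) :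
      fderiv ℝ (f i) u v = u i * fderiv ℝ g u v + v i * g u := by
    have h1 : HasFDerivAt (fun u : Fin d → ℝ => u i)
      (ContinuousLinearMap.proj (R := ℝ) (φ := fun _ : Fin d => ℝ) i) u := hasFDerivAt_apply i u
    have := (h1.mul (hg.differentiable one_ne_zero u).hasFDerivAt).fderiv
    simp only [f]
    erw [this]
    simp [mul_comm]
  have hsum (u : Fin d → ℝ) (hu1 : u ⬝ᵥ u = 1) :
      ∑ i, fderiv ℝ (f i) u ((A i).mulVec u)
        = (d - 1 + k) * ((y ⬝ᵥ u) * g u) - fderiv ℝ g u y := by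
    -- Euler's identity in coordinates. In the final coefficient, `k` comes from here, `d` from the
    -- number of indices and `-1` from `e3`.
    have e1 : ∑ i, u i * fderiv ℝ g u (Pi.single i 1) = k * g u := by
      rw [← hk u]
      conv_rhs => rw [← Finset.univ_sum_single u, map_sum]
      refine Finset.sum_congr rfl fun i _ => ?_
      rw [Finset.univ_sum_single u, ← smul_eq_mul, ← map_smul, ← Pi.single_smul]
      simp
    have e2 : ∑ i, u i * u i = 1 := hu1
    have e3 : ∑ i, y i * u i = y ⬝ᵥ u := rfl
    have e4 (i) : fderiv ℝ (f i) u ((A i).mulVec u)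
        = (y ⬝ᵥ u) * (u i * fderiv ℝ g u (Pi.single i 1)) - (u i * u i) * fderiv ℝ g u y
          + (y ⬝ᵥ u) * g u - (y i * u i) * g u := by
      rw [hfd, hAu]; simp; ring
    simp only [e4, Finset.sum_add_distrib, Finset.sum_sub_distrib, ← Finset.mul_sum,
      ← Finset.sum_mul, e1, e2, e3]
    simp; ring
  have hint (i) : Integrable (fun U => fderiv ℝ (f i) (orthogonalCol j U)
      ((A i).mulVec (orthogonalCol j U))) (orthogonalHaar d) :=
    integrable_orthogonalHaar ((((hf i).continuous_fderiv one_ne_zero).comp hu).clm_apply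
      (Continuous.matrix_mulVec continuous_const hu))
  have h0 := integral_finsetSum (μ := orthogonalHaar d) Finset.univ fun i _ => hint i
  simp only [integral_fderiv_skew_eq_zero j (hA _) (hf _), Finset.sum_const_zero] at h0
  simp only [hsum _ (orthogonalCol_dotProduct_self j _)] at h0
  rw [integral_sub, integral_const_mul] at h0
  · linarith
  · exact integrable_orthogonalHaar (continuous_const.mul
      ((continuous_const.dotProduct hu).mul (hg.continuous.comp hu)))
  · exact integrable_orthogonalHaar ((hg'.comp hu).clm_apply continuous_const)

/-! ### Moments of linear forms on the sphere. -/

/-- The mixed moments of two linear forms over the unit sphere. -/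
noncomputable def sphereMoment {d : ℕ} (j : Fin d) (x y : Fin d → ℝ) (a b : ℕ) : ℝ :=
  ∫ U, (x ⬝ᵥ orthogonalCol j U) ^ a * (y ⬝ᵥ orthogonalCol j U) ^ b ∂(orthogonalHaar d)

theorem hasFDerivAt_dotProduct_left {d : ℕ} (x u : Fin d → ℝ) :
    HasFDerivAt (fun u : Fin d → ℝ => x ⬝ᵥ u)
      (LinearMap.toContinuousLinearMap (dotProductBilin ℝ ℝ x)) u :=
  (LinearMap.toContinuousLinearMap (dotProductBilin ℝ ℝ x)).hasFDerivAt

/-- Integration by parts for `g(u) = ⟨x,u⟩^a ⟨y,u⟩^b`, homogeneous of degree `a + b`. The truncated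
`a - 1` and `b - 1` are harmless: at zero their coefficients vanish. -/
theorem sphereMoment_succ_right {d : ℕ} (j : Fin d) (x y : Fin d → ℝ) (a b : ℕ) :
    ((d : ℝ) - 1 + (a + b)) * sphereMoment j x y a (b + 1)
      = a * (x ⬝ᵥ y) * sphereMoment j x y (a - 1) b
        + b * (y ⬝ᵥ y) * sphereMoment j x y a (b - 1) := by
  have hu := continuous_orthogonalCol j
  let g : (Fin d → ℝ) → ℝ := fun u => (x ⬝ᵥ u) ^ a * (y ⬝ᵥ u) ^ b
  have hc (z : Fin d → ℝ) : ContDiff ℝ 1 (fun u => z ⬝ᵥ u) :=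
    (LinearMap.toContinuousLinearMap (dotProductBilin ℝ ℝ z)).contDiff
  have hg : ContDiff ℝ 1 g := ((hc x).pow a).mul ((hc y).pow b)
  have hgd (u v : Fin d → ℝ) : fderiv ℝ g u v
      = a * (x ⬝ᵥ v) * ((x ⬝ᵥ u) ^ (a - 1) * (y ⬝ᵥ u) ^ b)
        + b * (y ⬝ᵥ v) * ((x ⬝ᵥ u) ^ a * (y ⬝ᵥ u) ^ (b - 1)) := by
    have := (((hasFDerivAt_dotProduct_left x u).pow a).mul
      ((hasFDerivAt_dotProduct_left y u).pow b)).fderiv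
    simp only [g]
    erw [this]
    simp
    ring
  have hk (u : Fin d → ℝ) : fderiv ℝ g u u = ((a : ℝ) + b) * g u := by
    rw [hgd]
    rcases a with _ | a <;> rcases b with _ | b <;> simp [g] <;> ring
  have key := integral_dotProduct_mul_of_homogeneous j y _ hg hk
  have hI (a b : ℕ) : Integrable (fun U => (x ⬝ᵥ orthogonalCol j U) ^ a *
      (y ⬝ᵥ orthogonalCol j U) ^ b) (orthogonalHaar d) :=
    integrable_orthogonalHaar (((continuous_const.dotProduct hu).pow a).mul
      ((continuous_const.dotProduct hu).pow b))
  simp only [hgd] at key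
  rw [integral_add ((hI _ _).const_mul _) ((hI _ _).const_mul _), integral_const_mul,
    integral_const_mul] at key
  simp only [sphereMoment]
  rw [← key]
  congr 2
  ext U
  simp only [g]
  ring

theorem sphereMoment_swap {d : ℕ} (j : Fin d) (x y : Fin d → ℝ) (a b : ℕ) :
    sphereMoment j x y a b = sphereMoment j y x b a := by
  simp only [sphereMoment, mul_comm]

/-- The recursion with the roles of `x` and `y` exchanged and the other exponent zero; `y` is a
dummy here. -/
theorem exists_dotProduct_self_pow_eq {d : ℕ} (j : Fin d) (l : ℕ) :
    ∃ c : ℝ, ∀ x y : Fin d → ℝ, (x ⬝ᵥ x) ^ l = c * sphereMoment j x y (2 * l) 0 := by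
  induction l with
  | zero => exact ⟨1, fun x y => by simp [sphereMoment]⟩
  | succ l ih =>
    obtain ⟨c, hc⟩ := ih
    refine ⟨c * ((d : ℝ) - 1 + (2 * l + 1)) / (2 * l + 1), fun x y => ?_⟩
    have h := sphereMoment_succ_right j y x 0 (2 * l + 1)
    have hl : (2 * l + 1 : ℝ) ≠ 0 := by positivity
    rw [pow_succ, hc x y, sphereMoment_swap j x y, sphereMoment_swap j x y]
    simp only [Nat.cast_zero, zero_mul, zero_add, Nat.add_sub_cancel] at h
    rw [show 2 * (l + 1) = 2 * l + 1 + 1 by ring]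
    push_cast at h
    field_simp
    linear_combination (-c) * h

theorem exists_dotProduct_pow_mul_eq_sum {d : ℕ} (j : Fin d) (m l : ℕ) :
    ∃ c : ℕ → ℝ, ∀ x y : Fin d → ℝ, y ⬝ᵥ y = 1 →
      (x ⬝ᵥ y) ^ m * (x ⬝ᵥ x) ^ l
        = ∑ i ∈ Finset.range (m / 2 + 1), c i * sphereMoment j x y (m + 2 * l) (m - 2 * i) := by
  induction m with
  | zero =>
    obtain ⟨c, hc⟩ := exists_dotProduct_self_pow_eq j l
    exact ⟨fun _ => c, fun x y _ => by simp [hc x y]⟩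
  | succ m ih =>
    obtain ⟨c, hc⟩ := ih
    let N : ℝ := m + 2 * l + 1
    have hN : N ≠ 0 := by positivity
    -- The recursion at `a = N = m+1+2l`, `b = m-2i`, divided by `N`: the old term `i` feeds the new
    -- terms `i` (via `α`) and `i + 1` (via `β`).
    let α : ℕ → ℝ := fun i => c i * (((d : ℝ) - 1 + (N + (m - 2 * i : ℕ))) / N)
    let β : ℕ → ℝ := fun i => c i * (-((m - 2 * i : ℕ) : ℝ) / N)
    refine ⟨fun i => (if i < m / 2 + 1 then α i else 0) + (if i = 0 then 0 else β (i - 1)),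
      fun x y hy => ?_⟩
    let S : ℕ → ℝ := fun i => sphereMoment j x y (m + 1 + 2 * l) (m + 1 - 2 * i)
    have step (i : ℕ) (hi : i < m / 2 + 1) :
        c i * ((x ⬝ᵥ y) * sphereMoment j x y (m + 2 * l) (m - 2 * i))
          = α i * S i + β i * S (i + 1) := by
      have h := sphereMoment_succ_right j x y (m + 1 + 2 * l) (m - 2 * i)
      rw [hy, show m + 1 + 2 * l - 1 = m + 2 * l by omega,
        show m - 2 * i + 1 = m + 1 - 2 * i by omega,
        show m - 2 * i - 1 = m + 1 - 2 * (i + 1) by omega] at h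
      have hN' : ((m + 1 + 2 * l : ℕ) : ℝ) = N := by simp only [N]; push_cast; ring
      rw [hN'] at h
      simp only [α, β, S]
      field_simp
      linear_combination (-c i) * h
    -- For even `m` the index range does not grow, and the overflow term at `i = m / 2` drops out
    -- since its factor `m - 2i` is zero.
    have hβ : ∀ i < m / 2 + 1, (m + 1) / 2 + 1 ≤ i + 1 → β i = 0 := by
      intro i hi hi'
      have : m - 2 * i = 0 := by omega
      simp [β, this]
    calc (x ⬝ᵥ y) ^ (m + 1) * (x ⬝ᵥ x) ^ l
        = (x ⬝ᵥ y) * ((x ⬝ᵥ y) ^ m * (x ⬝ᵥ x) ^ l) := by ring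
      _ = ∑ i ∈ Finset.range (m / 2 + 1), (α i * S i + β i * S (i + 1)) := by
        rw [hc x y hy, Finset.mul_sum]
        refine Finset.sum_congr rfl fun i hi => ?_
        rw [← step i (Finset.mem_range.1 hi)]; ring
      _ = ∑ i ∈ Finset.range ((m + 1) / 2 + 1),
            ((if i < m / 2 + 1 then α i else 0) + (if i = 0 then 0 else β (i - 1))) * S i := by
        simp only [add_mul, Finset.sum_add_distrib]
        rcases Nat.even_or_odd' m with ⟨k, rfl | rfl⟩
        · rw [show (2 * k + 1) / 2 = k by omega, show 2 * k / 2 = k by omega] at *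
          congr 1
          · exact Finset.sum_congr rfl fun i hi => by rw [if_pos (Finset.mem_range.1 hi)]
          · rw [Finset.sum_range_succ, hβ k (by omega) (by omega), Finset.sum_range_succ']
            simp
        · rw [show (2 * k + 1 + 1) / 2 = k + 1 by omega, show (2 * k + 1) / 2 = k by omega]
          congr 1
          · rw [Finset.sum_range_succ _ (k + 1), if_neg (lt_irrefl _), zero_mul, add_zero]
            exact Finset.sum_congr rfl fun i hi => by rw [if_pos (Finset.mem_range.1 hi)]
          · rw [Finset.sum_range_succ' _ (k + 1)]
            simp

/-! ### From projections to unit vectors. -/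

theorem grassmannianConj_coordProj_one {d : ℕ} (hd : 1 ≤ d)
    (U : Matrix.orthogonalGroup (Fin d) ℝ) :
    (grassmannianConj U ⟨coordProj 1 d, coordProj_mem hd⟩).1
      = Matrix.vecMulVec (orthogonalCol ⟨0, hd⟩ U) (orthogonalCol ⟨0, hd⟩ U) := by
  have h : coordProj 1 d = Matrix.vecMulVec (Pi.single ⟨0, hd⟩ 1) (Pi.single ⟨0, hd⟩ 1) := by
    ext i i'
    simp only [coordProj, Matrix.diagonal_apply, Matrix.vecMulVec_apply, Pi.single_apply,
      Fin.ext_iff]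
    grind
  simp only [grassmannianConj, h, Matrix.mul_vecMulVec, Matrix.vecMulVec_mul, orthogonalCol,
    Matrix.vecMul_transpose]

theorem continuous_grassmannianConj {k d : ℕ} (P : Grassmannian k d) :
    Continuous fun U => grassmannianConj U P := by
  refine Continuous.subtype_mk ?_ _
  fun_prop

theorem mixedTraceMoment_symOuter_eq_sphereMoment {d : ℕ} (hd : 1 ≤ d) (p q : ℕ)
    (x y : EuclideanSpace ℝ (Fin d)) :
    mixedTraceMoment (k := 1) hd p q (symOuter x y) (Matrix.vecMulVec x.ofLp x.ofLp)
      = sphereMoment ⟨0, hd⟩ x.ofLp y.ofLp (p + 2 * q) p := by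
  have hcont (M : Fin (p + q) → Matrix (Fin d) (Fin d) ℝ) :
      Continuous fun P : Grassmannian 1 d => ∏ i, (P.1 * M i).trace := by
    refine continuous_finsetProd _ fun i _ => ?_
    exact (continuous_subtype_val.matrix_mul continuous_const).matrix_trace
  rw [mixedTraceMoment, traceMoment, grassmannianMeasure, integral_map
    (continuous_grassmannianConj _).measurable.aemeasurable (hcont _).aestronglyMeasurable,
    sphereMoment]
  congr 1
  ext U
  rw [grassmannianConj_coordProj_one hd, Fin.prod_univ_add]
  simp only [Fin.append_left, Fin.append_right, Finset.prod_const, Finset.card_univ,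
    Fintype.card_fin]
  set u := orthogonalCol ⟨0, hd⟩ U
  have h1 : (Matrix.vecMulVec u u * symOuter x y).trace = (x.ofLp ⬝ᵥ u) * (y.ofLp ⬝ᵥ u) := by
    simp only [symOuter, Matrix.mul_smul, Matrix.mul_add, Matrix.vecMulVec_mul_vecMulVec,
      Matrix.trace_smul, Matrix.trace_add, Matrix.trace_vecMulVec, smul_dotProduct,
      dotProduct_comm u, smul_eq_mul]
    ring
  have h2 : (Matrix.vecMulVec u u * Matrix.vecMulVec x.ofLp x.ofLp).trace
      = (x.ofLp ⬝ᵥ u) * (x.ofLp ⬝ᵥ u) := by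
    simp only [Matrix.vecMulVec_mul_vecMulVec, Matrix.trace_vecMulVec, smul_dotProduct,
      dotProduct_comm u, smul_eq_mul]
  rw [h1, h2]
  ring

theorem proposition3p3 (m l d : ℕ) (hd : 1 ≤ d) (hml : m + l ≤ d) :
    ∃ a : Fin (m / 2 + 1) → ℝ, ∀ x y : EuclideanSpace ℝ (Fin d), ‖y‖ = 1 →
      inner ℝ x y ^ m * ‖x‖ ^ (2 * l) =
        ∑ i : Fin (m / 2 + 1), a i *
          mixedTraceMoment (k := 1) hd (m - 2 * (i : ℕ)) (l + (i : ℕ)) (symOuter x y)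
            (Matrix.vecMulVec x.ofLp x.ofLp) := by
  obtain ⟨c, hc⟩ := exists_dotProduct_pow_mul_eq_sum (⟨0, hd⟩ : Fin d) m l
  have hinner (x y : EuclideanSpace ℝ (Fin d)) : inner ℝ x y = x.ofLp ⬝ᵥ y.ofLp := by
    rw [EuclideanSpace.inner_eq_star_dotProduct, dotProduct_comm, star_trivial]
  have hnorm (x : EuclideanSpace ℝ (Fin d)) : ‖x‖ ^ 2 = x.ofLp ⬝ᵥ x.ofLp := by
    rw [← hinner, real_inner_self_eq_norm_sq]
  refine ⟨fun i => c i, fun x y hy => ?_⟩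
  rw [pow_mul, hnorm, hinner, hc _ _ (by rw [← hnorm, hy, one_pow]), Finset.sum_range]
  refine Finset.sum_congr rfl fun i _ => ?_
  have hi := i.2
  rw [mixedTraceMoment_symOuter_eq_sphereMoment,
    -- The truncated subtraction is exact because `i ≤ m / 2`.
    show m - 2 * (i : ℕ) + 2 * (l + i) = m + 2 * l by omega]
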